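/- Let $q$ be a prime power and let $k>1$ be an integer. A cyclic code of length $n$ over $\mathbb{F}_q$ is a linear subspace $\mathcal{C}\subseteq\mathbb{F}_q^n$ that is closed under the circular shift $(c_0,c_1,\dots,c_{n-1})\mapsto(c_1,\dots,c_{n-1},c_0)$. Let $\mathcal{N}$ be the number of different cyclic codes $\mathcal{C}$ of length $q^k-1$ over $\mathbb{F}_q$ with the following weight distribution: $\mathcal{C}$ has exactly $1$ codeword of Hamming weight $0$, exactly $(q-1)(q^k-1)$ codewords of Hamming weight $q^{k-1}(q-1)-1$, exactly $q^k-1$ codewords of Hamming weight $q^{k-1}(q-1)$, exactly $q-1$ codewords of Hamming weight $q^k-1$, and no codewords of any other weight. Then $$\mathcal{N}=\frac{\phi(q^k-1)\,(q-1)}{k},$$ where $\phi$ denotes the Euler $\phi$-function. -/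

import Mathlib

/-- A linear code `C` of length `n` over `F` is cyclic if it is closed under the circular shift
of coordinates, `(c_0, c_1, …, c_{n-1}) ↦ (c_1, …, c_{n-1}, c_0)`. -/
def IsCyclicCode {F : Type*} [Field F] {n : ℕ} (C : Submodule F (Fin n → F)) : Prop :=
  ∀ c ∈ C, (fun i => c (finRotate n i)) ∈ C

/-- The weight distribution of a code: the number of codewords of each Hamming weight `w`. -/
noncomputable def weightDistribution {F : Type*} [Field F] [DecidableEq F] {n : ℕ}
    (C : Submodule F (Fin n → F)) (w : ℕ) : ℕ :=
  {c : Fin n → F | c ∈ C ∧ hammingNorm c = w}.ncard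

/-- The three-weight table: the frequency of the weight `w`; weights that are not listed
do not occur. For `2 ≤ q` and `2 ≤ k` the four listed weights are distinct. -/
def threeWeightTable (q k : ℕ) (w : ℕ) : ℕ :=
  if w = 0 then 1
  else if w = q ^ (k - 1) * (q - 1) - 1 then (q - 1) * (q ^ k - 1)
  else if w = q ^ (k - 1) * (q - 1) then q ^ k - 1
  else if w = q ^ k - 1 then q - 1
  else 0

/-! Let `n = q^k - 1` and let `K` be the extension of `F` with `q^k` elements. The codes in question
are exactly the spaces of words `c_i = λ^i (ℓ(α^i) + b)`, with `ℓ` a functional on `K` and `b` a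
scalar, where `λ` is a unit of `F` and `α` generates the units of `K`. Two pairs `(λ, α)` give the
same code iff the `λ` agree and the `α` are Galois conjugate. So the `(q - 1) φ(n)` pairs fall into
classes of size `k`.

That these codes have the required weights is a count of points on affine hyperplanes of `K`. The
converse, `exists_eq_twistedCode`, has three inputs. The words of full weight form a punctured line
stable under the shift, so they include a geometric progression `e = (λ^i)`. The second moment of
the number of zeros is the least that dimension permits, so no two distinct coordinates are
proportional on the code (`eq_of_forall_eq_zero`). Finally, divide the shift by `λ` and let `T` be
its transpose. It moves the coordinate functional `P` through `n` distinct points of the affine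
hyperplane `f e = 1`, which has `n + 1` points. The remaining point `Q` is therefore fixed, and with
`Q` as origin `T` permutes the nonzero vectors of a space in one cycle. Such an operator is
multiplication by a primitive element (`exists_orderOf_eq_and_linearMap`). -/

section

open Polynomial Module

/-! ### Operators that are a single cycle on nonzero vectors -/

/-- A linear operator permuting the nonzero vectors in a single cycle is multiplication by a
primitive element, up to a linear map from the field of the same size. -/
theorem exists_orderOf_eq_and_linearMap {F V K : Type*} [Field F] [AddCommGroup V] [Module F V]
    [Field K] [Fintype K] [Algebra F K] (T : End F V) (v : V) (n : ℕ) (hn : 0 < n)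
    (hK : Fintype.card K = n + 1) (hv : v ≠ 0) (htrans : ∀ w ≠ 0, ∃ i : ℕ, (T ^ i) v = w)
    (hper : (T ^ n) v = v) (hmin : ∀ i : ℕ, (T ^ i) v = v → n ∣ i) :
    ∃ α : Kˣ, orderOf α = n ∧ ∃ φ : K →ₗ[F] V, ∀ i : ℕ, φ ((α : K) ^ i) = (T ^ i) v := by
  -- The orbit of `v` covers the nonzero vectors, so an operator commuting with `T` is determined by
  -- its value at `v`.
  have hext : ∀ A B : End F V, Commute A T → Commute B T → A v = B v → A = B := by
    intro A B hA hB h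
    ext w
    by_cases hw : w = 0
    · simp [hw]
    · obtain ⟨i, rfl⟩ := htrans w hw
      have h1 := congrArg (fun f : End F V => f v) (hA.pow_right i).eq
      have h2 := congrArg (fun f : End F V => f v) (hB.pow_right i).eq
      simp only [Module.End.mul_apply] at h1 h2
      rw [h1, h2, h]
  have hTn : T ^ n = 1 := hext _ _ (Commute.pow_left rfl n) (Commute.one_left T)
    (by simpa using hper)
  have hcomm : ∀ b : F[X], Commute (aeval T b) T := fun b => by
    have : Commute (aeval T b) (aeval T (X : F[X])) := by
      rw [commute_iff_eq, ← map_mul, ← map_mul, mul_comm]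
    simpa using this
  -- Every element of `F[T]` is zero or a power of `T`, hence zero or invertible; this makes the
  -- minimal polynomial prime.
  have hdich : ∀ b : F[X], aeval T b = 0 ∨ ∃ i : ℕ, aeval T b = T ^ i := by
    intro b
    by_cases hb : aeval T b v = 0
    · exact Or.inl (hext _ _ (hcomm b) (Commute.zero_left T) (by simpa using hb))
    · obtain ⟨i, hi⟩ := htrans _ hb
      exact Or.inr ⟨i, hext _ _ (hcomm b) (Commute.pow_left rfl i) hi.symm⟩
  have hunit : ∀ i : ℕ, IsUnit (T ^ i) := fun i =>
    (IsUnit.of_pow_eq_one hTn hn.ne').pow i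
  have hdvd : minpoly F T ∣ X ^ n - 1 := minpoly.dvd F T (by simp [hTn])
  have hint : IsIntegral F T := ⟨X ^ n - 1, monic_X_pow_sub_C 1 hn.ne', by simp [hTn]⟩
  have : Nontrivial V := ⟨⟨v, 0, hv⟩⟩
  have hprime : Prime (minpoly F T) := by
    refine ⟨minpoly.ne_zero hint, minpoly.not_isUnit F T, fun a b hab => ?_⟩
    have h0 : aeval T a * aeval T b = 0 := by
      rw [← map_mul]
      obtain ⟨c, hc⟩ := hab
      rw [hc, map_mul, minpoly.aeval, zero_mul]
    rcases hdich a with ha | ⟨i, hi⟩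
    · exact Or.inl (minpoly.dvd F T ha)
    · refine Or.inr (minpoly.dvd F T ?_)
      rw [hi] at h0
      exact (hunit i).mul_right_eq_zero.mp h0
  -- `X ^ n - 1` divides `X ^ |K| - X`, so the minimal polynomial of `T` has a root in `K`.
  have hsplit : (((X ^ n - 1 : F[X])).map (algebraMap F K)).Splits := by
    have h := (FiniteField.isSplittingField_sub K K).splits
    have hne : (X ^ Fintype.card K - X : K[X]).map (algebraMap K K) ≠ 0 := by
      simpa using FiniteField.X_pow_card_sub_X_ne_zero K Fintype.one_lt_card
    refine Splits.of_dvd h hne ?_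
    refine ⟨X, ?_⟩
    simp [hK]
    ring
  have hne : (X ^ n - 1 : F[X]) ≠ 0 := (monic_X_pow_sub_C 1 hn.ne').ne_zero
  obtain ⟨a, ha⟩ := Splits.exists_eval_eq_zero
    (Splits.of_dvd hsplit ((Polynomial.map_ne_zero_iff (algebraMap F K).injective).mpr hne)
      (Polynomial.map_dvd (algebraMap F K) hdvd))
    (by rw [degree_map]; exact (minpoly.degree_pos hint).ne')
  rw [eval_map_algebraMap] at ha
  have hmp : minpoly F T = minpoly F a :=
    minpoly.eq_of_irreducible_of_monic hprime.irreducible ha (minpoly.monic hint)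
  have han : a ^ n = 1 := by
    obtain ⟨c, hc⟩ := hdvd
    have := congrArg (aeval a) hc
    rw [map_mul, ha, zero_mul] at this
    simpa [sub_eq_zero] using this
  have hzero : ∀ b : F[X], aeval a b = 0 → aeval T b = 0 := by
    intro b hb
    obtain ⟨c, rfl⟩ := hmp ▸ minpoly.dvd F a hb
    simp
  have haunit : IsUnit a := IsUnit.of_pow_eq_one han hn.ne'
  obtain ⟨α, rfl⟩ := haunit
  have hord : orderOf α = n := by
    refine Nat.dvd_antisymm (orderOf_dvd_of_pow_eq_one (Units.ext (by simpa using han))) ?_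
    refine hmin _ ?_
    have h1 : aeval (α : K) (X ^ orderOf α - 1 : F[X]) = 0 := by
      rw [map_sub, map_pow, aeval_X, ← Units.val_pow_eq_pow_val, pow_orderOf_eq_one]
      simp
    have h2 := hzero _ h1
    rw [map_sub, map_pow, aeval_X, map_one, sub_eq_zero] at h2
    simp [h2]
  refine ⟨α, hord, ?_⟩
  have hcardU : Nat.card Kˣ = n := by
    rw [Nat.card_units, Nat.card_eq_fintype_card, hK]; simp
  have hsurj : Function.Surjective (aeval (R := F) (α : K)).toLinearMap := by
    intro x
    by_cases hx : x = 0
    · exact ⟨0, by simp [hx]⟩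
    · have hmem : Units.mk0 x hx ∈ Subgroup.zpowers α := by
        have : Subgroup.zpowers α = ⊤ := by
          apply Subgroup.eq_top_of_card_eq
          rw [Nat.card_zpowers, hord, hcardU]
        rw [this]; trivial
      rw [← mem_powers_iff_mem_zpowers] at hmem
      obtain ⟨i, hi⟩ := hmem
      refine ⟨X ^ i, ?_⟩
      have := congrArg Units.val hi
      simpa using this
  -- The map wanted is `b(α) ↦ b(T) v`. A linear section `s` picks the polynomial `b`; the choice is
  -- immaterial because `α` and `T` share their minimal polynomial.
  obtain ⟨s, hs⟩ := LinearMap.exists_rightInverse_of_surjective _ (LinearMap.range_eq_top.mpr hsurj)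
  refine ⟨(LinearMap.applyₗ v) ∘ₗ (aeval T).toLinearMap ∘ₗ s, fun i => ?_⟩
  have h1 : aeval (α : K) (s ((α : K) ^ i) - X ^ i) = 0 := by
    rw [map_sub, map_pow (aeval (α : K)), aeval_X, sub_eq_zero]
    exact congrArg (fun f : K →ₗ[F] K => f ((α : K) ^ i)) hs
  have h2 := hzero _ h1
  rw [map_sub, map_pow (aeval T), aeval_X, sub_eq_zero] at h2
  simp [h2]

/-! ### Twisted codes and conjugate roots -/

section

variable {F K : Type*} [Field F] [Field K] [Algebra F K]

/-- The sequence `i ↦ λ ^ i (ℓ (α ^ i) + b)` attached to a functional `ℓ` and a scalar `b`. -/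
noncomputable def twistedEncoder (n : ℕ) (lam : Fˣ) (α : Kˣ) :
    (Dual F K × F) →ₗ[F] (Fin n → F) where
  toFun p i := (lam : F) ^ (i : ℕ) * (p.1 ((α : K) ^ (i : ℕ)) + p.2)
  map_add' p p' := by ext i; simp; ring
  map_smul' c p := by ext i; simp; ring

theorem twistedEncoder_apply (n : ℕ) (lam : Fˣ) (α : Kˣ) (p : Dual F K × F) (i : Fin n) :
    twistedEncoder n lam α p i = (lam : F) ^ (i : ℕ) * (p.1 ((α : K) ^ (i : ℕ)) + p.2) := rfl

/-- The cyclic code with check roots `λ` and the conjugates of `λα`. -/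
noncomputable def twistedCode (n : ℕ) (lam : Fˣ) (α : Kˣ) : Submodule F (Fin n → F) :=
  LinearMap.range (twistedEncoder n lam α)

/-- The recurrence given by the minimal polynomial `m` of `α` turns each sequence `g(α^i) + b` into
a constant. Applied to `f(β^i)`, it shows that `f(m(β) β^i)` is independent of `i`, so `m(β) (β - 1)
= 0`, and `β ≠ 1`. -/
theorem isConjRoot_of_twistedCode_eq {n : ℕ} (hn : 1 < n) {lam : Fˣ} {α β : Kˣ}
    (hα : α ^ n = 1) (hβ : orderOf β = n) (h : twistedCode n lam β ≤ twistedCode n lam α) :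
    aeval (β : K) (minpoly F (α : K)) = 0 := by
  have hβn : β ^ n = 1 := hβ ▸ pow_orderOf_eq_one β
  have hmod : ∀ γ : Kˣ, γ ^ n = 1 → ∀ i : ℕ, (γ : K) ^ (i % n) = (γ : K) ^ i := by
    intro γ hγ i
    rw [← Units.val_pow_eq_pow_val, ← Units.val_pow_eq_pow_val, ← pow_eq_pow_mod i hγ]
  have hseq : ∀ f : Dual F K, ∃ g : Dual F K, ∃ b : F, ∀ i : ℕ,
      f ((β : K) ^ i) = g ((α : K) ^ i) + b := by
    intro f
    obtain ⟨⟨g, b⟩, hgb⟩ := h ⟨(f, 0), rfl⟩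
    refine ⟨g, b, fun i => ?_⟩
    have h1 := congrFun hgb ⟨i % n, Nat.mod_lt _ (by omega)⟩
    rw [twistedEncoder_apply, twistedEncoder_apply] at h1
    have h2 := mul_left_cancel₀ (pow_ne_zero _ lam.ne_zero) h1
    simp only [hmod α hα, hmod β hβn, add_zero] at h2
    exact h2.symm
  have hpoly : ∀ (f : Dual F K) (γ : K) (m : F[X]) (i : ℕ),
      f (aeval γ m * γ ^ i) = m.sum fun j c => c * f (γ ^ (j + i)) := by
    intro f γ m i
    rw [aeval_eq_sum_range, Finset.sum_mul, map_sum, sum_over_range _ (by simp)]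
    refine Finset.sum_congr rfl fun j _ => ?_
    rw [smul_mul_assoc, map_smul, ← pow_add, smul_eq_mul]
  have hconst : ∀ f : Dual F K,
      f (aeval (β : K) (minpoly F (α : K)) * ((β : K) ^ 1 - (β : K) ^ 0)) = 0 := by
    intro f
    obtain ⟨g, b, hgb⟩ := hseq f
    have key : ∀ i : ℕ, f (aeval (β : K) (minpoly F (α : K)) * (β : K) ^ i) =
        (minpoly F (α : K)).sum fun _ c => c * b := by
      intro i
      have h0 := hpoly g (α : K) (minpoly F (α : K)) i
      rw [minpoly.aeval, zero_mul, map_zero] at h0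
      rw [hpoly]
      simp only [hgb, mul_add]
      rw [Polynomial.sum_add, ← h0, zero_add]
    rw [mul_sub, map_sub, key, key, sub_self]
  have hz := (Module.forall_dual_apply_eq_zero_iff F _).mp hconst
  rcases mul_eq_zero.mp hz with h | h
  · exact h
  · exfalso
    rw [pow_one, pow_zero, sub_eq_zero] at h
    have : β = 1 := Units.ext h
    rw [this, orderOf_one] at hβ
    omega

/-- Precomposing the functional with `σ` absorbs the change of root; `σ.symm` gives the reverse
inclusion. -/
theorem twistedCode_map_algEquiv (n : ℕ) (lam : Fˣ) (α : Kˣ) (σ : K ≃ₐ[F] K) :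
    twistedCode n lam (Units.map (σ : K →* K) α) = twistedCode n lam α := by
  have hle : ∀ (σ : K ≃ₐ[F] K) (α : Kˣ),
      twistedCode n lam (Units.map (σ : K →* K) α) ≤ twistedCode n lam α := by
    rintro σ α _ ⟨⟨f, b⟩, rfl⟩
    refine ⟨(f ∘ₗ σ.toLinearMap, b), ?_⟩
    ext i
    simp [twistedEncoder_apply]
  refine le_antisymm (hle σ α) ?_
  convert hle σ.symm (Units.map (σ : K →* K) α) using 2
  ext; simp

end

/-! ### Cyclicity and weights of twisted codes -/

theorem finRotate_val_eq_mod {n : ℕ} (i : Fin n) : (finRotate n i : ℕ) = ((i : ℕ) + 1) % n := by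
  obtain _ | n := n
  · exact i.elim0
  · rw [finRotate_apply, Fin.val_add]; simp

theorem hammingNorm_add_card_zeros {F : Type*} [Field F] [DecidableEq F]
    {n : ℕ} (c : Fin n → F) :
    hammingNorm c + (Finset.univ.filter fun i => c i = 0).card = n := by
  have h := Finset.card_filter_add_card_filter_not (s := (Finset.univ : Finset (Fin n)))
    (fun i => c i = 0)
  rw [Finset.card_univ, Fintype.card_fin] at h
  rw [hammingNorm, add_comm]
  exact h

theorem natCard_dual {F K : Type*} [Field F] [Field K] [Fintype K] [Algebra F K]
    {q k : ℕ} (hK : Fintype.card K = q ^ k) :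
    Nat.card (Dual F K) = q ^ k := by
  rw [Module.natCard_eq_pow_finrank (K := F), Subspace.dual_finrank_eq,
    ← Module.natCard_eq_pow_finrank, Nat.card_eq_fintype_card, hK]

theorem isCyclicCode_twistedCode {F K : Type*} [Field F] [Fintype F] [DecidableEq F]
    [Field K] [Algebra F K] {n : ℕ} (hdvd : Fintype.card F - 1 ∣ n) (lam : Fˣ) {α : Kˣ}
    (hα : orderOf α = n) : IsCyclicCode (twistedCode (F := F) n lam α) := by
  have hα1 : α ^ n = 1 := hα ▸ pow_orderOf_eq_one α
  have hlam : lam ^ n = 1 := by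
    obtain ⟨c, rfl⟩ := hdvd
    rw [pow_mul, ← Fintype.card_units, pow_card_eq_one, one_pow]
  rintro _ ⟨⟨f, b⟩, rfl⟩
  -- Shifting replaces `ℓ` by `λ ℓ(α ·)` and `b` by `λ b`; the wrap-around is harmless since `λ^n =
  -- α^n = 1`.
  refine ⟨(lam • (f ∘ₗ LinearMap.mulLeft F (α : K)), lam * b), ?_⟩
  ext i
  rw [twistedEncoder_apply, twistedEncoder_apply, finRotate_val_eq_mod]
  simp only [← Units.val_pow_eq_pow_val, ← pow_eq_pow_mod _ hlam, ← pow_eq_pow_mod _ hα1]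
  simp [pow_succ, mul_comm, Units.smul_def]
  ring

section

variable {F K : Type*} [Field F] [Fintype F] [DecidableEq F] [Field K] [Fintype K] [Algebra F K]

theorem card_fiber_dual {V : Type*} [AddCommGroup V] [Module F V] [Fintype V] {q k : ℕ}
    (hk : 0 < k) (hq : Fintype.card F = q) (hV : Fintype.card V = q ^ k) {f : Dual F V} (hf : f ≠ 0)
    (c : F) :
    (Finset.univ.filter fun x => f x = c).card = q ^ (k - 1) := by
  classical
  have hsurj : Function.Surjective f := LinearMap.surjective hf
  have hall : ∀ d : F, (Finset.univ.filter fun x => f x = d).card =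
      (Finset.univ.filter fun x => f x = c).card := fun d =>
    AddMonoidHom.card_fiber_eq_of_mem_range f.toAddMonoidHom (hsurj d) (hsurj c)
  have h1 := Finset.card_eq_sum_card_fiberwise (f := f) (s := Finset.univ) (t := Finset.univ)
    (fun _ _ => Finset.mem_univ _)
  simp only [hall, Finset.sum_const, smul_eq_mul] at h1
  rw [Finset.card_univ, Finset.card_univ, hV, hq] at h1
  have hq0 : 0 < q := hq ▸ Fintype.card_pos
  obtain ⟨j, rfl⟩ : ∃ j, k = j + 1 := ⟨k - 1, by omega⟩
  rw [pow_succ, mul_comm] at h1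
  simpa using (Nat.eq_of_mul_eq_mul_left hq0 h1).symm

theorem bijective_pow_of_orderOf {n : ℕ} (hK : Fintype.card K = n + 1) {α : Kˣ}
    (hα : orderOf α = n) : Function.Bijective fun i : Fin n => α ^ (i : ℕ) := by
  classical
  rw [Fintype.bijective_iff_injective_and_card]
  constructor
  · intro i j hij
    exact Fin.ext (pow_injOn_Iio_orderOf (by simp [hα]) (by simp [hα]) hij)
  · rw [Fintype.card_fin, Fintype.card_units, hK]; simp

theorem card_pow_fiber [DecidableEq K] {n : ℕ} (hK : Fintype.card K = n + 1) {α : Kˣ}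
    (hα : orderOf α = n) (P : K → Prop) [DecidablePred P] :
    (Finset.univ.filter fun i : Fin n => P ((α : K) ^ (i : ℕ))).card =
      (Finset.univ.filter fun x : K => x ≠ 0 ∧ P x).card := by
  classical
  refine Finset.card_bij (fun i _ => (α : K) ^ (i : ℕ)) ?_ ?_ ?_
  · intro i hi
    simpa using hi
  · intro i _ j _ hij
    refine (bijective_pow_of_orderOf hK hα).1 (Units.ext ?_)
    simpa using hij
  · intro x hx
    simp only [Finset.mem_filter, Finset.mem_univ, true_and] at hx
    obtain ⟨i, hi⟩ := (bijective_pow_of_orderOf hK hα).2 (Units.mk0 x hx.1)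
    have hi' : (α : K) ^ (i : ℕ) = x := by simpa using congrArg Units.val hi
    exact ⟨i, by simpa [hi'] using hx.2, hi'⟩

-- The powers of `α` run once through the nonzero `x`, so zeros of the word are nonzero points of
-- the hyperplane `ℓ(x) = -b`. The origin lies on it, and is to be discarded, exactly when `b = 0`.
open Classical in
theorem hammingNorm_twistedEncoder {q k n : ℕ} (hk : 0 < k) (hq : Fintype.card F = q)
    (hn : q ^ k = n + 1) (hK : Fintype.card K = n + 1) (lam : Fˣ) {α : Kˣ} (hα : orderOf α = n)
    (p : Dual F K × F) :
    hammingNorm (twistedEncoder n lam α p) =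
      if p.1 = 0 then (if p.2 = 0 then 0 else n)
      else if p.2 = 0 then n + 1 - q ^ (k - 1) else n - q ^ (k - 1) := by
  obtain ⟨f, b⟩ := p
  have h1 := hammingNorm_add_card_zeros (twistedEncoder n lam α (f, b))
  have h2 : (Finset.univ.filter fun i => twistedEncoder n lam α (f, b) i = 0).card =
      (Finset.univ.filter fun x : K => x ≠ 0 ∧ f x + b = 0).card := by
    rw [← card_pow_fiber hK hα (fun x => f x + b = 0)]
    congr 1
    ext i
    simp [twistedEncoder_apply]
  rw [h2] at h1
  by_cases hf : f = 0
  · subst hf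
    by_cases hb : b = 0
    · subst hb
      rw [if_pos rfl, if_pos rfl, hammingNorm_eq_zero]
      exact map_zero _
    · simpa [hb] using h1
  · have h3 := card_fiber_dual hk hq (hn ▸ hK) hf (-b)
    by_cases hb : b = 0
    · subst hb
      have h4 : (Finset.univ.filter fun x : K => x ≠ 0 ∧ f x + 0 = 0) =
          (Finset.univ.filter fun x => f x = -0).erase 0 := by
        ext x; simp
      rw [h4, Finset.card_erase_of_mem (by simp), h3] at h1
      simp only [hf, if_false, if_true]
      have : 0 < q ^ (k - 1) := pow_pos (hq ▸ Fintype.card_pos) _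
      omega
    · have h4 : (Finset.univ.filter fun x : K => x ≠ 0 ∧ f x + b = 0) =
          (Finset.univ.filter fun x => f x = -b) := by
        ext x
        simp only [Finset.mem_filter, Finset.mem_univ, true_and, ← eq_neg_iff_add_eq_zero]
        refine ⟨fun h => h.2, fun h => ⟨?_, h⟩⟩
        rintro rfl
        simp [eq_comm, hb] at h
      rw [h4, h3] at h1
      simp only [hf, if_false, hb]
      omega

/-- These bounds give `0 < n - t < n + 1 - t < n` for `t = q^(k-1)`, which separates the four
weights. -/
theorem table_arith {q k n : ℕ} (hk : 1 < k) (hq : 2 ≤ q) (hn : q ^ k = n + 1) :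
    q ^ k = q ^ (k - 1) * (q - 1) + q ^ (k - 1) ∧ 2 ≤ q ^ (k - 1) ∧
      q ^ (k - 1) ≤ q ^ (k - 1) * (q - 1) := by
  obtain ⟨j, rfl⟩ : ∃ j, k = j + 1 := ⟨k - 1, by omega⟩
  obtain ⟨r, rfl⟩ : ∃ r, q = r + 1 := ⟨q - 1, by omega⟩
  refine ⟨by simp; ring, ?_, ?_⟩
  · calc 2 ≤ r + 1 := hq
      _ = (r + 1) ^ 1 := (pow_one _).symm
      _ ≤ (r + 1) ^ (j + 1 - 1) := Nat.pow_le_pow_right (by omega) (by omega)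
  · exact Nat.le_mul_of_pos_right _ (by omega)

instance finite_dual : Finite (Dual F K) := Module.finite_of_finite F

theorem twistedEncoder_injective {q k n : ℕ} (hk : 1 < k) (hq : Fintype.card F = q)
    (hn : q ^ k = n + 1) (hK : Fintype.card K = n + 1) (lam : Fˣ) {α : Kˣ} (hα : orderOf α = n) :
    Function.Injective (twistedEncoder (F := F) n lam α) := by
  classical
  rw [injective_iff_map_eq_zero]
  intro p hp
  have h := hammingNorm_twistedEncoder (by omega) hq hn hK lam hα p
  have h2q : 2 ≤ q := hq ▸ Fintype.one_lt_card
  obtain ⟨h1, h2, h3⟩ := table_arith hk h2q hn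
  rw [hp, hammingNorm_zero] at h
  split_ifs at h with ha hb hb
  · exact Prod.ext ha hb
  all_goals omega

theorem weightDistribution_twistedCode {q k n : ℕ} (hk : 1 < k) (hq : Fintype.card F = q)
    (hn : q ^ k = n + 1) (hK : Fintype.card K = n + 1) (lam : Fˣ) {α : Kˣ} (hα : orderOf α = n) :
    weightDistribution (twistedCode (F := F) n lam α) = threeWeightTable q k := by
  classical
  funext w
  have h2q : 2 ≤ q := hq ▸ Fintype.one_lt_card
  obtain ⟨h1, h2, h3⟩ := table_arith hk h2q hn
  have hset : {c : Fin n → F | c ∈ twistedCode n lam α ∧ hammingNorm c = w} =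
      twistedEncoder n lam α '' {p | hammingNorm (twistedEncoder n lam α p) = w} := by
    ext c
    constructor
    · rintro ⟨⟨p, rfl⟩, h⟩
      exact ⟨p, h, rfl⟩
    · rintro ⟨p, h, rfl⟩
      exact ⟨⟨p, rfl⟩, h⟩
  rw [weightDistribution, hset,
    Set.ncard_image_of_injective _ (twistedEncoder_injective hk hq hn hK lam hα)]
  simp only [hammingNorm_twistedEncoder (by omega : 0 < k) hq hn hK lam hα]
  have cD : ({0}ᶜ : Set (Dual F K)).ncard = n := by
    rw [Set.ncard_compl, natCard_dual (hn ▸ hK), Set.ncard_singleton]; omega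
  have cF : ({0}ᶜ : Set F).ncard = q - 1 := by
    rw [Set.ncard_compl, Nat.card_eq_fintype_card, hq, Set.ncard_singleton]
  have key : ∀ s : Set (Dual F K × F), ∀ A : Set (Dual F K), ∀ B : Set F,
      (∀ f b, (f, b) ∈ s ↔ f ∈ A ∧ b ∈ B) → s.ncard = A.ncard * B.ncard := by
    intro s A B h
    rw [← Set.ncard_prod]
    congr 1
    ext ⟨f, b⟩
    simp [h]
  rw [threeWeightTable]
  split_ifs with w0 w1 w2 w3
  · rw [key _ {0} {0}]
    · simp
    · intro f b
      simp only [Set.mem_ofPred_eq, Set.mem_singleton_iff]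
      split_ifs <;> simp_all <;> omega
  · rw [key _ {0}ᶜ {0}ᶜ, cD, cF, hn, mul_comm]; · rfl
    intro f b
    simp only [Set.mem_ofPred_eq, Set.mem_singleton_iff, Set.mem_compl_iff]
    split_ifs <;> simp_all <;> omega
  · rw [key _ {0}ᶜ {0}, cD, Set.ncard_singleton, hn]; · simp
    intro f b
    simp only [Set.mem_ofPred_eq, Set.mem_singleton_iff, Set.mem_compl_iff]
    split_ifs <;> simp_all <;> omega
  · rw [key _ {0} {0}ᶜ, cF, Set.ncard_singleton, one_mul]
    intro f b
    simp only [Set.mem_ofPred_eq, Set.mem_singleton_iff, Set.mem_compl_iff]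
    split_ifs <;> simp_all <;> omega
  · rw [key _ ∅ ∅]
    · simp
    intro f b
    simp only [Set.mem_ofPred_eq, Set.mem_empty_iff_false]
    split_ifs <;> simp_all <;> omega

end

/-! ### Moments of the weight distribution -/

theorem sum_hammingNorm_eq_sum_weightDistribution {F : Type*} [Field F] [DecidableEq F]
    {n : ℕ} (C : Submodule F (Fin n → F)) [Fintype C]
    (g : ℕ → ℕ) :
    ∑ c : C, g (hammingNorm (c : Fin n → F)) =
      ∑ w ∈ Finset.range (n + 1), weightDistribution C w * g w := by
  classical
  rw [← Finset.sum_fiberwise_of_maps_to (t := Finset.range (n + 1))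
    (g := fun c : C => hammingNorm (c : Fin n → F))]
  · refine Finset.sum_congr rfl fun w _ => ?_
    rw [Finset.sum_congr rfl (g := fun _ => g w), Finset.sum_const, smul_eq_mul]
    · congr 1
      rw [weightDistribution, ← Set.ncard_coe_finset, ← Set.ncard_image_of_injective _
        (Subtype.val_injective (p := fun c => c ∈ C))]
      congr 1
      ext c
      simp [and_comm]
    · intro c hc
      simp only [Finset.mem_filter] at hc
      rw [hc.2]
  · intro c _
    have := hammingNorm_le_card_fintype (x := (c : Fin n → F))
    rw [Fintype.card_fin] at this
    simpa [Nat.lt_succ_iff] using this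

theorem natCard_le_natCard_ker_mul {F : Type*} [Field F]
    {V W : Type*} [AddCommGroup V] [Module F V] [AddCommGroup W]
    [Module F W] [Finite W] (f : V →ₗ[F] W) :
    Nat.card V ≤ Nat.card (LinearMap.ker f) * Nat.card W := by
  rw [Submodule.card_eq_card_quotient_mul_card (LinearMap.ker f)]
  refine Nat.mul_le_mul_left _ ?_
  rw [Nat.card_congr f.quotKerEquivRange.toEquiv]
  exact Nat.card_le_card_of_injective _ Subtype.val_injective

section

variable {F : Type*} [Field F] [Fintype F] [DecidableEq F]

theorem sum_threeWeightTable {q k n : ℕ} (hk : 1 < k) (hq : 2 ≤ q) (hn : q ^ k = n + 1)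
    (g : ℕ → ℕ) :
    ∑ w ∈ Finset.range (n + 1), threeWeightTable q k w * g w =
      g 0 + (q - 1) * n * g (n - q ^ (k - 1)) + n * g (n + 1 - q ^ (k - 1)) + (q - 1) * g n := by
  obtain ⟨h1, h2, h3⟩ := table_arith hk hq hn
  have e1 : q ^ (k - 1) * (q - 1) - 1 = n - q ^ (k - 1) := by omega
  have e2 : q ^ (k - 1) * (q - 1) = n + 1 - q ^ (k - 1) := by omega
  have e3 : q ^ k - 1 = n := by omega
  have key : ∀ w, threeWeightTable q k w * g w = (if w = 0 then g 0 else 0) +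
      (if w = n - q ^ (k - 1) then (q - 1) * n * g (n - q ^ (k - 1)) else 0) +
      (if w = n + 1 - q ^ (k - 1) then n * g (n + 1 - q ^ (k - 1)) else 0) +
      (if w = n then (q - 1) * g n else 0) := by
    intro w
    rw [threeWeightTable, e1, e2, e3]
    by_cases w0 : w = 0
    · rw [if_pos w0, if_pos w0, if_neg (by omega), if_neg (by omega), if_neg (by omega), w0]; ring
    by_cases w1 : w = n - q ^ (k - 1)
    · rw [if_neg w0, if_neg w0, if_pos w1, if_pos w1, if_neg (by omega), if_neg (by omega), w1]
      ring
    by_cases w2 : w = n + 1 - q ^ (k - 1)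
    · rw [if_neg w0, if_neg w0, if_neg w1, if_neg w1, if_pos w2, if_pos w2, if_neg (by omega), w2]
      ring
    by_cases w3 : w = n
    · rw [if_neg w0, if_neg w0, if_neg w1, if_neg w1, if_neg w2, if_neg w2, if_pos w3, if_pos w3,
        w3]
      ring
    · simp [w0, w1, w2, w3]
  simp only [key, Finset.sum_add_distrib, Finset.sum_ite_eq', Finset.mem_range]
  rw [if_pos (by omega), if_pos (by omega), if_pos (by omega), if_pos (by omega)]

theorem natCard_of_threeWeightTable {q k n : ℕ} (hk : 1 < k) (hq : 2 ≤ q) (hn : q ^ k = n + 1)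
    {C : Submodule F (Fin n → F)} (hC : weightDistribution C = threeWeightTable q k) :
    Nat.card C = q ^ (k + 1) := by
  have := Fintype.ofFinite C
  have h := sum_hammingNorm_eq_sum_weightDistribution C (fun _ => 1)
  rw [hC, sum_threeWeightTable hk hq hn] at h
  rw [Nat.card_eq_fintype_card, pow_succ, hn]
  obtain ⟨r, rfl⟩ : ∃ r, q = r + 1 := ⟨q - 1, by omega⟩
  simp only [Finset.sum_const, Finset.card_univ, smul_eq_mul, mul_one, Nat.add_sub_cancel] at h
  rw [h]; ring

/-- Count triples `(c, i, j)` with `c i = c j = 0`. Codimension bounds give at least `q^k` words for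
each diagonal pair and `q^(k-1)` for each other pair. The weight table makes the total equal to the
sum of these bounds, so an off-diagonal pair with a larger count is impossible. -/
theorem eq_of_forall_eq_zero {q k n : ℕ} (hk : 1 < k) (hq : Fintype.card F = q)
    (hn : q ^ k = n + 1) {C : Submodule F (Fin n → F)}
    (hC : weightDistribution C = threeWeightTable q k) {i j : Fin n}
    (hij : ∀ c ∈ C, c i = 0 → c j = 0) : i = j := by
  classical
  have h2q : 2 ≤ q := hq ▸ Fintype.one_lt_card
  by_contra hne
  have := Fintype.ofFinite C
  have hcard : Fintype.card C = q ^ (k + 1) := by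
    rw [← Nat.card_eq_fintype_card, natCard_of_threeWeightTable hk h2q hn hC]
  let N : Fin n × Fin n → ℕ := fun p =>
    (Finset.univ.filter fun c : C => (c : Fin n → F) p.1 = 0 ∧ (c : Fin n → F) p.2 = 0).card
  let ev : Fin n → Dual F C := fun i => (LinearMap.proj i) ∘ₗ C.subtype
  have hN1 : ∀ i, q ^ k ≤ N (i, i) := by
    intro i
    have h := natCard_le_natCard_ker_mul (ev i)
    have e : Nat.card (LinearMap.ker (ev i)) = N (i, i) := by
      rw [Nat.card_eq_fintype_card, Fintype.card_subtype]
      simp [N, ev]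
    rw [e, Nat.card_eq_fintype_card, hcard, Nat.card_eq_fintype_card, hq, pow_succ] at h
    exact Nat.le_of_mul_le_mul_right h (by omega)
  have hN2 : ∀ p, q ^ (k - 1) ≤ N p := by
    intro p
    have h := natCard_le_natCard_ker_mul ((ev p.1).prod (ev p.2))
    have e : Nat.card (LinearMap.ker ((ev p.1).prod (ev p.2))) = N p := by
      rw [Nat.card_eq_fintype_card, Fintype.card_subtype]
      simp [N, ev]
    have e2 : q ^ (k + 1) = q ^ (k - 1) * (q * q) := by
      rw [← pow_two, ← pow_add]; congr 1; omega
    rw [e, Nat.card_eq_fintype_card, hcard, Nat.card_prod, Nat.card_eq_fintype_card, hq, e2] at h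
    exact Nat.le_of_mul_le_mul_right h (by positivity)
  obtain ⟨h1, h2, h3⟩ := table_arith hk h2q hn
  have hlt : q ^ (k - 1) < q ^ k := Nat.pow_lt_pow_right (by omega) (by omega)
  have hN3 : q ^ (k - 1) < N (i, j) := by
    refine hlt.trans_le ((hN1 i).trans (Finset.card_le_card ?_))
    intro c hc
    simp only [Finset.mem_filter, Finset.mem_univ, true_and] at hc ⊢
    exact ⟨hc.1, hij c c.2 hc.1⟩
  have hsumlt : ∑ p : Fin n × Fin n, (q ^ (k - 1) + if p.1 = p.2 then q ^ k - q ^ (k - 1) else 0) <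
      ∑ p, N p := by
    refine Finset.sum_lt_sum ?_ ⟨(i, j), Finset.mem_univ _, by simpa [hne] using hN3⟩
    rintro ⟨a, b⟩ _
    by_cases hab : a = b
    · subst hab
      have := hN1 a
      simp only [if_true]; omega
    · simpa [hab] using hN2 (a, b)
  have hlow : ∑ p : Fin n × Fin n, (q ^ (k - 1) + if p.1 = p.2 then q ^ k - q ^ (k - 1) else 0) =
      n * n * q ^ (k - 1) + n * (q ^ k - q ^ (k - 1)) := by
    rw [Finset.sum_add_distrib, Fintype.sum_prod_type
      (f := fun p : Fin n × Fin n => if p.1 = p.2 then _ else _)]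
    simp
  have hsum : ∑ p, N p = ∑ c : C, (n - hammingNorm (c : Fin n → F)) ^ 2 := by
    have hz : ∀ c : C, (n - hammingNorm (c : Fin n → F)) ^ 2 =
        ∑ p : Fin n × Fin n,
          if (c : Fin n → F) p.1 = 0 ∧ (c : Fin n → F) p.2 = 0 then 1 else 0 := by
      intro c
      have h := hammingNorm_add_card_zeros (c : Fin n → F)
      have h' : n - hammingNorm (c : Fin n → F) =
        (Finset.univ.filter fun i => (c : Fin n → F) i = 0).card := by omega
      rw [h', pow_two, ← Finset.card_product, ← Finset.filter_product, Finset.univ_product_univ,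
        Finset.card_filter]
    simp only [hz]
    rw [Finset.sum_comm]
    refine Finset.sum_congr rfl fun p _ => ?_
    rw [← Finset.card_filter]
  rw [hsum, hlow, sum_hammingNorm_eq_sum_weightDistribution C (fun w => (n - w) ^ 2), hC,
    sum_threeWeightTable hk h2q hn] at hsumlt
  -- Writing `q = r + 1` and `q^(k-1) = t + 1` removes the truncated subtractions and makes the
  -- equality a polynomial identity.
  obtain ⟨r, rfl⟩ : ∃ r, q = r + 1 := ⟨q - 1, by omega⟩
  obtain ⟨t, ht⟩ : ∃ t, (r + 1) ^ (k - 1) = t + 1 := ⟨(r + 1) ^ (k - 1) - 1, by omega⟩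
  rw [hn, ht] at hsumlt h1
  simp only [Nat.add_sub_cancel] at hsumlt h1
  have hnn : n = r * t + r + t := by linarith
  have e1 : n - (n - (t + 1)) = t + 1 := by omega
  have e2 : n - (n + 1 - (t + 1)) = t := by omega
  have e3 : n + 1 - (t + 1) = r * t + r := by rw [hnn]; omega
  rw [e1, e2, e3] at hsumlt
  refine hsumlt.ne ?_
  simp only [Nat.sub_self, Nat.sub_zero]
  rw [hnn]
  ring

/-! ### Words of full weight -/

/-- The full-weight words form the punctured line spanned by a geometric progression. -/
theorem exists_geometric_word {q k n : ℕ} (hk : 1 < k) (hq : Fintype.card F = q)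
    (hn : q ^ k = n + 1) {C : Submodule F (Fin n → F)} (hcyc : IsCyclicCode C)
    (hC : weightDistribution C = threeWeightTable q k) :
    ∃ lam : Fˣ, (fun i : Fin n => (lam : F) ^ (i : ℕ)) ∈ C ∧
      ∀ mu : Fˣ, (fun i : Fin n => (mu : F) ^ (i : ℕ)) ∈ C → mu = lam := by
  have h2q : 2 ≤ q := hq ▸ Fintype.one_lt_card
  obtain ⟨h1, h2, h3⟩ := table_arith hk h2q hn
  have hfull : ∀ c : Fin n → F, hammingNorm c = n ↔ ∀ i, c i ≠ 0 := by
    intro c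
    have h := hammingNorm_add_card_zeros c
    rw [show hammingNorm c = n ↔ (Finset.univ.filter fun i => c i = 0).card = 0 by omega,
      Finset.card_eq_zero, Finset.filter_eq_empty_iff]
    simp
  have hcount : {c : Fin n → F | c ∈ C ∧ hammingNorm c = n}.ncard = q - 1 := by
    have := congrFun hC n
    rw [weightDistribution, threeWeightTable, if_neg (by omega), if_neg (by omega),
      if_neg (by omega), if_pos (by omega)] at this
    exact this
  obtain ⟨u, huC, hun⟩ := Set.nonempty_of_ncard_ne_zero (by omega :
    {c : Fin n → F | c ∈ C ∧ hammingNorm c = n}.ncard ≠ 0)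
  rw [hfull] at hun
  have hline : ∀ c ∈ C, (∀ i, c i ≠ 0) → ∃ a : Fˣ, a • u = c := by
    have hinj : Function.Injective fun a : Fˣ => a • u := by
      intro a b hab
      have := congrFun hab ⟨0, by omega⟩
      simp only [Pi.smul_apply, Units.smul_def, smul_eq_mul] at this
      exact Units.ext (mul_right_cancel₀ (hun _) this)
    -- The `q - 1` nonzero multiples of `u` already exhaust the words of full weight.
    have hr : (Set.range fun a : Fˣ => a • u) = {c | c ∈ C ∧ hammingNorm c = n} := by
      refine Set.eq_of_subset_of_ncard_le ?_ ?_ (Set.toFinite _)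
      · rintro _ ⟨a, rfl⟩
        refine ⟨C.smul_mem (a : F) huC, (hfull _).mpr fun i => ?_⟩
        exact mul_ne_zero a.ne_zero (hun i)
      · rw [hcount, ← Set.image_univ, Set.ncard_image_of_injective _ hinj, Set.ncard_univ,
          Nat.card_eq_fintype_card, Fintype.card_units, hq]
    intro c hc hci
    have : c ∈ Set.range fun a : Fˣ => a • u := hr ▸ ⟨hc, (hfull c).mpr hci⟩
    exact this
  obtain ⟨lam, hlam⟩ := hline _ (hcyc u huC) fun i => hun _
  have hu : ∀ m : ℕ, ∀ hm : m < n, u ⟨m, hm⟩ = (lam : F) ^ m * u ⟨0, by omega⟩ := by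
    intro m
    induction m with
    | zero => intro hm; simp
    | succ m ih =>
      intro hm
      have h := congrFun hlam ⟨m, by omega⟩
      have e : finRotate n ⟨m, by omega⟩ = ⟨m + 1, hm⟩ := by
        ext; rw [finRotate_val_eq_mod]; exact Nat.mod_eq_of_lt hm
      rw [e] at h
      rw [← h, Pi.smul_apply, Units.smul_def, ih, smul_eq_mul]
      ring
  refine ⟨lam, ?_, ?_⟩
  · convert C.smul_mem (u ⟨0, by omega⟩)⁻¹ huC using 1
    ext i
    rw [Pi.smul_apply, hu i i.2, smul_eq_mul]
    field_simp [hun]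
  · intro mu hmu
    obtain ⟨a, ha⟩ := hline _ hmu fun i => pow_ne_zero _ mu.ne_zero
    have ha0 := congrFun ha ⟨0, by omega⟩
    have ha1 := congrFun ha ⟨1, by omega⟩
    rw [Pi.smul_apply, Units.smul_def, smul_eq_mul] at ha0 ha1
    rw [hu 1 (by omega)] at ha1
    apply Units.ext
    simp only [pow_one, pow_zero] at ha0 ha1
    linear_combination (lam : F) * ha0 - ha1

end

/-! ### Recovering `λ` and `α` from a code -/

/-- The cyclic shift, untwisted by `λ`, as an operator on a cyclic code. -/
noncomputable def twistedShift {F : Type*} [Field F]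
    {n : ℕ} {C : Submodule F (Fin n → F)} (hcyc : IsCyclicCode C)
    (lam : Fˣ) : C →ₗ[F] C where
  toFun c := ⟨((lam⁻¹ : Fˣ) : F) • fun i => (c : Fin n → F) (finRotate n i),
    C.smul_mem _ (hcyc c c.2)⟩
  map_add' c d := by ext i; simp [mul_add]
  map_smul' a c := by ext i; simp; ring

/-- Reading position `0` after `m` shifts expresses every coordinate through the orbit of a single
functional. -/
theorem twistedShift_pow_apply {F : Type*} [Field F]
    {n : ℕ} {C : Submodule F (Fin n → F)} (hcyc : IsCyclicCode C)
    (lam : Fˣ) (hn : 0 < n) (c : C) (m : ℕ) :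
    (((twistedShift hcyc lam ^ m : End F C) c : C) : Fin n → F) ⟨0, hn⟩ =
      ((lam⁻¹ ^ m : Fˣ) : F) * (c : Fin n → F) ⟨m % n, Nat.mod_lt _ hn⟩ := by
  induction m generalizing c with
  | zero => simp
  | succ m ih =>
    rw [pow_succ, Module.End.mul_apply, ih]
    have e : finRotate n ⟨m % n, Nat.mod_lt _ hn⟩ = ⟨(m + 1) % n, Nat.mod_lt _ hn⟩ := by
      ext; rw [finRotate_val_eq_mod]; simp
    simp only [twistedShift, LinearMap.coe_mk, AddHom.coe_mk, Pi.smul_apply, e, smul_eq_mul]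
    rw [pow_succ, Units.val_mul]
    ring

section

variable {F K : Type*} [Field F] [Fintype F] [DecidableEq F] [Field K] [Fintype K] [Algebra F K]

theorem exists_eq_twistedCode {q k n : ℕ} (hk : 1 < k) (hq : Fintype.card F = q)
    (hn : q ^ k = n + 1) (hK : Fintype.card K = n + 1)
    {C : Submodule F (Fin n → F)} (hcyc : IsCyclicCode C)
    (hC : weightDistribution C = threeWeightTable q k) :
    ∃ lam : Fˣ, ∃ α : Kˣ, orderOf α = n ∧ C = twistedCode n lam α := by
  classical
  have h2q : 2 ≤ q := hq ▸ Fintype.one_lt_card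
  obtain ⟨h1, h2, h3⟩ := table_arith hk h2q hn
  have hn0 : 0 < n := by omega
  have hcardC := natCard_of_threeWeightTable hk h2q hn hC
  obtain ⟨lam, hlam, -⟩ := exists_geometric_word hk hq hn hcyc hC
  have hlamn : lam ^ n = 1 := by
    have hdvd : q - 1 ∣ n := by
      have := Nat.sub_dvd_pow_sub_pow q 1 k
      rw [one_pow, hn] at this
      simpa using this
    obtain ⟨c, rfl⟩ := hdvd
    rw [← hq, pow_mul, ← Fintype.card_units, pow_card_eq_one, one_pow]
  have hmod : ∀ i : ℕ, lam ^ (i % n) = lam ^ i := fun i => (pow_eq_pow_mod i hlamn).symm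
  let τ := twistedShift hcyc lam
  let T : End F (Dual F C) := LinearMap.dualMap τ
  let P : Dual F C := (LinearMap.proj (⟨0, hn0⟩ : Fin n)) ∘ₗ C.subtype
  let e : C := ⟨_, hlam⟩
  have hTpow : ∀ (m : ℕ) (f : Dual F C) (c : C), (T ^ m) f c = f ((τ ^ m : End F C) c) := by
    intro m
    induction m with
    | zero => intro f c; rfl
    | succ m ih =>
      intro f c
      rw [pow_succ', pow_succ, Module.End.mul_apply, Module.End.mul_apply]
      exact ih f (τ c)
  have hP : ∀ (m : ℕ) (c : C), (T ^ m) P c =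
      ((lam⁻¹ ^ m : Fˣ) : F) * (c : Fin n → F) ⟨m % n, Nat.mod_lt _ hn0⟩ := by
    intro m c
    rw [hTpow]
    exact twistedShift_pow_apply hcyc lam hn0 c m
  have hPe : ∀ m : ℕ, (T ^ m) P e = 1 := by
    intro m
    rw [hP]
    change ((lam⁻¹ ^ m : Fˣ) : F) * (lam : F) ^ (m % n) = 1
    rw [← Units.val_pow_eq_pow_val, hmod, ← Units.val_mul, inv_pow, inv_mul_cancel, Units.val_one]
  have hPmod : ∀ m : ℕ, (T ^ (m % n)) P = (T ^ m) P := by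
    intro m
    ext c
    rw [hP, hP, inv_pow, inv_pow, hmod]
    simp only [Nat.mod_mod]
  have hPinj : ∀ i j : ℕ, (T ^ i) P = (T ^ j) P → i % n = j % n := by
    intro i j hij
    have := eq_of_forall_eq_zero (i := ⟨i % n, Nat.mod_lt _ hn0⟩) (j := ⟨j % n, Nat.mod_lt _ hn0⟩)
      hk hq hn hC ?_
    · simpa using this
    · intro c hc h
      have h' := congrArg (fun f : Dual F C => f ⟨c, hc⟩) hij
      simp only [hP, h, mul_zero] at h'
      exact (mul_eq_zero.mp h'.symm).resolve_left (Units.ne_zero _)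
  have hτe : τ e = e := by
    ext i
    change ((lam⁻¹ : Fˣ) : F) * (lam : F) ^ (finRotate n i : ℕ) = (lam : F) ^ (i : ℕ)
    rw [finRotate_val_eq_mod, ← Units.val_pow_eq_pow_val, hmod, pow_succ', Units.val_mul,
      ← mul_assoc, Units.inv_mul, one_mul, Units.val_pow_eq_pow_val]
  have hTe : ∀ f : Dual F C, T f e = f e := fun f => congrArg f hτe
  have hTinj : Function.Injective T := by
    have : Finite C := inferInstance
    have hτ : Function.Injective τ := by
      rw [injective_iff_map_eq_zero]
      intro c hc
      ext i
      have h := congrArg (fun c : C => (c : Fin n → F) ((finRotate n).symm i)) hc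
      change ((lam⁻¹ : Fˣ) : F) * (c : Fin n → F) (finRotate n ((finRotate n).symm i)) = 0 at h
      rw [Equiv.apply_symm_apply] at h
      exact (mul_eq_zero.mp h).resolve_left (Units.ne_zero _)
    exact LinearMap.dualMap_injective_of_surjective (Finite.injective_iff_surjective.mp hτ)
  -- the affine hyperplane of functionals that take the value `1` at `e`
  have : Finite (Dual F C) := Module.finite_of_finite F
  have := Fintype.ofFinite (Dual F C)
  have hcardD : Fintype.card (Dual F C) = q ^ (k + 1) := by
    rw [← Nat.card_eq_fintype_card, Module.natCard_eq_pow_finrank (K := F),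
      Subspace.dual_finrank_eq, ← Module.natCard_eq_pow_finrank, hcardC]
  have hev : Dual.eval F C e ≠ 0 := by
    intro h
    have := congrArg (fun f => f P) h
    have h1 := hPe 0
    simp only [pow_zero, Module.End.one_apply] at h1
    simp [Dual.eval_apply, h1] at this
  have hA := card_fiber_dual (Nat.succ_pos k) hq hcardD hev 1
  set A := Finset.univ.filter fun f : Dual F C => Dual.eval F C e f = 1 with hAdef
  have hmemA : ∀ f, f ∈ A ↔ f e = 1 := by
    intro f
    rw [hAdef, Finset.mem_filter]
    simp [Dual.eval_apply]
  let I : Finset (Dual F C) := (Finset.range n).image fun i => (T ^ i) P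
  have hI : I.card = n := by
    rw [Finset.card_image_of_injOn, Finset.card_range]
    intro i hi j hj hij
    have := hPinj i j hij
    simp only [Finset.coe_range, Set.mem_Iio] at hi hj
    rwa [Nat.mod_eq_of_lt hi, Nat.mod_eq_of_lt hj] at this
  have hmemI : ∀ m, (T ^ m) P ∈ I := fun m => by
    rw [← hPmod]
    exact Finset.mem_image_of_mem _ (Finset.mem_range.mpr (Nat.mod_lt _ hn0))
  have hIA : I ⊆ A := by
    intro f hf
    obtain ⟨i, -, rfl⟩ := Finset.mem_image.mp hf
    exact (hmemA _).mpr (hPe i)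
  have hdiff : (A \ I).card = 1 := by
    rw [Finset.card_sdiff_of_subset hIA, hA, hI, Nat.succ_sub_one, hn]; omega
  obtain ⟨Q, hQ⟩ := Finset.card_eq_one.mp hdiff
  have hQmem : Q ∈ A ∧ Q ∉ I := by
    rw [← Finset.mem_sdiff, hQ]; exact Finset.mem_singleton_self Q
  have hQe : Q e = 1 := (hmemA Q).mp hQmem.1
  have hAcases : ∀ f : Dual F C, f e = 1 → f = Q ∨ ∃ i, (T ^ i) P = f := by
    intro f hf
    by_cases hfI : f ∈ I
    · obtain ⟨i, -, h⟩ := Finset.mem_image.mp hfI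
      exact Or.inr ⟨i, h⟩
    · have : f ∈ A \ I := Finset.mem_sdiff.mpr ⟨(hmemA f).mpr hf, hfI⟩
      rw [hQ] at this
      exact Or.inl (Finset.mem_singleton.mp this)
  have hTn : (T ^ n) P = P := by
    rw [← hPmod, Nat.mod_self]; rfl
  have hTQ : T Q = Q := by
    rcases hAcases (T Q) ((hTe Q).trans hQe) with h | ⟨i, h⟩
    · exact h
    · exfalso
      apply hQmem.2
      -- If `T Q` were in the orbit of `P`, stepping back once by `T^(n-1)` and using injectivity
      -- would put `Q` in it too.
      have : T ((T ^ (i + (n - 1))) P) = T Q := by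
        rw [← Module.End.mul_apply, ← pow_succ', ← h, add_assoc, Nat.sub_add_cancel hn0, pow_add,
          Module.End.mul_apply, hTn]
      rw [← hTinj this]
      exact hmemI _
  have hTmQ : ∀ m : ℕ, (T ^ m) Q = Q := by
    intro m
    induction m with
    | zero => rfl
    | succ m ih => rw [pow_succ, Module.End.mul_apply, hTQ, ih]
  let V : Submodule F (Dual F C) := LinearMap.ker (Dual.eval F C e)
  have hmemV : ∀ f : Dual F C, f ∈ V ↔ f e = 0 := fun f => by
    simp [V, Dual.eval_apply]
  have hTV : ∀ f ∈ V, T f ∈ V := by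
    intro f hf
    rw [hmemV] at hf ⊢
    rw [hTe, hf]
  let v : V := ⟨P - Q, by
    have := hPe 0
    rw [hmemV, LinearMap.sub_apply, hQe]
    exact sub_eq_zero.mpr this⟩
  have hTv : ∀ m : ℕ, (((T.restrict hTV) ^ m) v : Dual F C) = (T ^ m) P - Q := by
    intro m
    rw [Module.End.pow_restrict, LinearMap.restrict_apply]
    change (T ^ m) (P - Q) = _
    rw [map_sub, hTmQ]
  obtain ⟨α, hα, φ, hφ⟩ := exists_orderOf_eq_and_linearMap (K := K) (T.restrict hTV) v n hn0 hK
    (by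
      intro h
      apply hQmem.2
      have h' : P - Q = 0 := congrArg Subtype.val h
      rw [← sub_eq_zero.mp h']
      exact hmemI 0)
    (by
      intro w hw
      have hwe := (hmemV _).mp w.2
      rcases hAcases (w + Q) (by rw [LinearMap.add_apply, hwe, hQe, zero_add]) with h | ⟨i, h⟩
      · exact absurd (Subtype.ext (by simpa using h)) hw
      · exact ⟨i, Subtype.ext (by rw [hTv, h, add_sub_cancel_right])⟩)
    (Subtype.ext (by rw [hTv, hTn]))
    (by
      intro i hi
      have h := congrArg Subtype.val hi
      rw [hTv] at h
      have h' := hPinj i 0 (sub_left_injective h)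
      rw [Nat.zero_mod] at h'
      exact Nat.dvd_of_mod_eq_zero h')
  refine ⟨lam, α, hα, ?_⟩
  -- Split `T^i P = (T^i P - Q) + Q`: the first term is `φ(α^i)` and gives `ℓ`, the second gives the
  -- constant `b = Q c`. Equality of the codes then follows from equal cardinality.
  have hle : C ≤ twistedCode n lam α := by
    intro c hc
    refine ⟨((Dual.eval F C ⟨c, hc⟩) ∘ₗ V.subtype ∘ₗ φ, Q ⟨c, hc⟩), ?_⟩
    ext i
    rw [twistedEncoder_apply]
    simp only [LinearMap.comp_apply, hφ, Submodule.subtype_apply, hTv, Dual.eval_apply,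
      LinearMap.sub_apply, sub_add_cancel, hP]
    rw [← Units.val_pow_eq_pow_val, ← mul_assoc, ← Units.val_mul, inv_pow, mul_inv_cancel,
      Units.val_one, one_mul]
    congr 1
    exact Fin.ext (Nat.mod_eq_of_lt i.2)
  apply SetLike.coe_injective
  refine Set.eq_of_subset_of_ncard_le hle ?_ (Set.toFinite _)
  have h' := natCard_of_threeWeightTable hk h2q hn
    (weightDistribution_twistedCode hk hq hn hK lam hα)
  exact (h'.trans hcardC.symm).le

end

/-! ### Counting the pairs `(λ, α)` -/

theorem algEquiv_map_injective {F K : Type*} [Field F] [Field K] [Fintype K] [Algebra F K]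
    {n : ℕ} (hK : Fintype.card K = n + 1) {α : Kˣ}
    (hα : orderOf α = n) :
    Function.Injective fun σ : K ≃ₐ[F] K => Units.map (σ : K →* K) α := by
  intro σ τ h
  ext x
  by_cases hx : x = 0
  · simp [hx]
  · obtain ⟨i, hi⟩ := (bijective_pow_of_orderOf hK hα).2 (Units.mk0 x hx)
    have hi' : (α : K) ^ (i : ℕ) = x := by simpa using congrArg Units.val hi
    have hv : σ (α : K) = τ (α : K) := congrArg Units.val h
    rw [← hi', map_pow, map_pow, hv]

section

variable {F K : Type*} [Field F] [Fintype F] [DecidableEq F] [Field K] [Fintype K] [Algebra F K]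

/-- The code contains only one geometric progression with ratio in `F` and first term `1`, which
recovers `λ`; a common minimal polynomial then gives `σ`. -/
theorem twistedCode_eq_iff {q k n : ℕ} (hk : 1 < k) (hq : Fintype.card F = q)
    (hn : q ^ k = n + 1) (hK : Fintype.card K = n + 1) (hdvd : q - 1 ∣ n) {lam mu : Fˣ} {α β : Kˣ}
    (hα : orderOf α = n) (hβ : orderOf β = n) :
    twistedCode n mu β = twistedCode n lam α ↔
      mu = lam ∧ ∃ σ : K ≃ₐ[F] K, Units.map (σ : K →* K) α = β := by
  have h2q : 2 ≤ q := hq ▸ Fintype.one_lt_card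
  obtain ⟨h1, h2, h3⟩ := table_arith hk h2q hn
  constructor
  · intro h
    have hgeom : ∀ (nu : Fˣ) (γ : Kˣ),
        (fun i : Fin n => (nu : F) ^ (i : ℕ)) ∈ twistedCode n nu γ := fun nu γ =>
      ⟨(0, 1), by ext i; simp [twistedEncoder_apply]⟩
    obtain ⟨nu, -, hnu⟩ := exists_geometric_word hk hq hn
      (isCyclicCode_twistedCode (hq ▸ hdvd) lam hα)
      (weightDistribution_twistedCode hk hq hn hK lam hα)
    have hml : mu = lam := (hnu mu (h ▸ hgeom mu β)).trans (hnu lam (hgeom lam α)).symm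
    subst hml
    refine ⟨rfl, ?_⟩
    have hroot := isConjRoot_of_twistedCode_eq (F := F) (by omega : 1 < n)
      (hα ▸ pow_orderOf_eq_one α) hβ h.le
    have hconj : IsConjRoot F (α : K) (β : K) :=
      minpoly.eq_of_irreducible_of_monic (minpoly.irreducible (Algebra.IsIntegral.isIntegral _))
        hroot (minpoly.monic (Algebra.IsIntegral.isIntegral _))
    obtain ⟨σ, hσ⟩ := isConjRoot_iff_exists_algEquiv.mp hconj.symm
    exact ⟨σ, Units.ext hσ⟩
  · rintro ⟨rfl, σ, rfl⟩
    exact twistedCode_map_algEquiv n mu α σ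

theorem ncard_threeWeightTable_mul {q k n : ℕ} (hk : 1 < k) (hq : Fintype.card F = q)
    (hn : q ^ k = n + 1) (hK : Fintype.card K = n + 1) (hrank : Module.finrank F K = k) :
    {C : Submodule F (Fin n → F) |
        IsCyclicCode C ∧ weightDistribution C = threeWeightTable q k}.ncard * k =
      Nat.totient n * (q - 1) := by
  classical
  have hdvd : q - 1 ∣ n := by
    have := Nat.sub_dvd_pow_sub_pow q 1 k
    rw [one_pow, hn] at this
    simpa using this
  let Φ : Fˣ × {α : Kˣ // orderOf α = n} → Submodule F (Fin n → F) :=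
    fun p => twistedCode n p.1 (p.2 : Kˣ)
  have hset : {C : Submodule F (Fin n → F) |
      IsCyclicCode C ∧ weightDistribution C = threeWeightTable q k} =
      (Finset.univ.image Φ : Finset _) := by
    ext C
    simp only [Finset.coe_image, Finset.coe_univ, Set.image_univ, Set.mem_range]
    constructor
    · rintro ⟨hcyc, hC⟩
      obtain ⟨lam, α, hα, h⟩ := exists_eq_twistedCode (K := K) hk hq hn hK hcyc hC
      exact ⟨(lam, ⟨α, hα⟩), h.symm⟩
    · rintro ⟨⟨lam, α, hα⟩, rfl⟩
      exact ⟨isCyclicCode_twistedCode (hq ▸ hdvd) lam hα,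
        weightDistribution_twistedCode hk hq hn hK lam hα⟩
  -- Each fibre is a free orbit of the Galois group, which has order `k`.
  have hfib : ∀ C ∈ Finset.univ.image Φ, (Finset.univ.filter fun p => Φ p = C).card = k := by
    intro C hC
    obtain ⟨⟨lam, α, hα⟩, -, rfl⟩ := Finset.mem_image.mp hC
    have hgal : Fintype.card (K ≃ₐ[F] K) = k := by
      rw [← Nat.card_eq_fintype_card, IsGalois.card_aut_eq_finrank, hrank]
    rw [← hgal, ← Finset.card_univ]
    symm
    refine Finset.card_bij (fun σ _ => (lam, ⟨Units.map (σ : K →* K) α, ?_⟩)) ?_ ?_ ?_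
    · rw [orderOf_injective _ (Units.map_injective σ.injective), hα]
    · intro σ _
      simp only [Finset.mem_filter, Finset.mem_univ, true_and]
      exact twistedCode_map_algEquiv n lam α σ
    · intro σ _ τ _ h
      exact algEquiv_map_injective hK hα (congrArg (fun p => (p.2 : Kˣ)) h)
    · rintro ⟨mu, β, hβ⟩ h
      simp only [Finset.mem_filter, Finset.mem_univ, true_and] at h
      obtain ⟨rfl, σ, rfl⟩ := (twistedCode_eq_iff hk hq hn hK hdvd hα hβ).mp h
      exact ⟨σ, Finset.mem_univ _, rfl⟩
  have hcard := Finset.card_eq_sum_card_image Φ Finset.univ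
  rw [Finset.sum_congr rfl hfib, Finset.sum_const, smul_eq_mul] at hcard
  rw [hset, Set.ncard_coe_finset, ← hcard, Finset.card_univ, Fintype.card_prod,
    Fintype.card_units, hq, mul_comm]
  congr 1
  rw [Fintype.card_subtype]
  refine IsCyclic.card_orderOf_eq_totient ?_
  rw [Fintype.card_units, hK, Nat.add_sub_cancel]

end

end

theorem corollary2 (q k : ℕ) (hk : 1 < k)
    (F : Type*) [Field F] [Fintype F] [DecidableEq F] (hq : Fintype.card F = q) :
    (({C : Submodule F (Fin (q ^ k - 1) → F) |
        IsCyclicCode C ∧ weightDistribution C = threeWeightTable q k}.ncard : ℕ) : ℚ)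
      = (Nat.totient (q ^ k - 1) : ℚ) * ((q : ℚ) - 1) / (k : ℚ) := by
  obtain ⟨p, hp⟩ := CharP.exists F
  have : Fact p.Prime := ⟨CharP.char_is_prime F p⟩
  have : NeZero k := ⟨by omega⟩
  have := Fintype.ofFinite (FiniteField.Extension F p k)
  have hq1 : 1 ≤ q := hq ▸ Fintype.card_pos
  have hn : q ^ k = q ^ k - 1 + 1 := (Nat.sub_add_cancel (Nat.one_le_pow _ _ hq1)).symm
  have hK : Fintype.card (FiniteField.Extension F p k) = q ^ k - 1 + 1 := by
    rw [← hn, ← Nat.card_eq_fintype_card, FiniteField.natCard_extension, Nat.card_eq_fintype_card,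
      hq]
  have h := ncard_threeWeightTable_mul hk hq hn hK (FiniteField.finrank_extension F p k)
  have hk0 : (k : ℚ) ≠ 0 := by exact_mod_cast (by omega : k ≠ 0)
  rw [eq_div_iff hk0]
  have h' := congrArg (Nat.cast : ℕ → ℚ) h
  rw [Nat.cast_mul, Nat.cast_mul, Nat.cast_sub hq1, Nat.cast_one] at h'
  exact h'
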